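/- **Canonicity of stable independence relations.** An *AECat* is a pair $(\mathcal C,\mathcal M)$ where $\mathcal C$ is an accessible category and $\mathcal M$ is a full subcategory of $\mathcal C$ (its objects are called *models*) that is itself accessible, such that $\mathcal M$ has directed colimits, the inclusion $\mathcal M\hookrightarrow\mathcal C$ preserves them, and every arrow of $\mathcal C$ is a monomorphism. It has the *amalgamation property* if for all arrows $N_1\leftarrow M\to N_2$ between models there are a model $U$ and arrows $N_1\to U\leftarrow N_2$ that make the square commute. An *extension* of a model $M$ is an arrow $M\to N$ with $N$ a model; arrows into $M$ and subobjects of $M$ are regarded as arrows into and subobjects of $N$ by composing with it. For arrows $a_i:A_i\to M$ and $a_i':A_i\to M'$ into models, $\operatorname{gtp}((a_i)_i;M)=\operatorname{gtp}((a'_i)_i;M')$ means that there are extensions $M\to N\leftarrow M'$ such that $a_i$ and $a_i'$ become equal as arrows into $N$ for all $i$; for tuples of subobjects $A_i\le M$, $A_i'\le M'$, equality of Galois types means that for some extensions $M\to N\leftarrow M'$ one has $A_i=A_i'$ as subobjects of $N$ for all $i$. An *independence relation* is a relation on triples of subobjects of models, written $A\perp^M_C B$ for $A,B,C\le M$. For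 arrows $a,b,\dots$ we write $A,B,\dots$ for the subobjects they represent. Consider the following properties; all cardinals $\lambda,\Upsilon(\lambda)$ are infinite and regular. - *Invariance*: if $A\perp^M_C B$ and $\operatorname{gtp}(A,B,C;M)=\operatorname{gtp}(A',B',C';M')$, then $A'\perp^{M'}_{C'}B'$. - *Monotonicity*: if $A\perp^M_C B$ and $B'\le B$, then $A\perp^M_C B'$. - *Base-monotonicity*: if $A\perp^M_C B$ and $C\le C'\le B$, then $A\perp^M_{C'}B$. - *Transitivity*: if $A\perp^M_B C$, $A\perp^M_C D$ and $B\le C$, then there are an extension $M\to N$ and $E\le N$ with $A\perp^N_B E$ and $C,D\le E$. - *Symmetry*: if $A\perp^M_C B$, then $B\perp^M_C A$. - *Existence*: for all arrows $a:A\to M$, $c:C\to M$ and all $B\le M$ there are an extension $M\to M'$ and an arrow $a':A\to M'$ with $A'\perp^{M'}_C B$ and $\operatorname{gtp}(a',c;M')=\operatorname{gtp}(a,c;M)$. - *Union*: if $(B_i)_{i\in I}$ is a directed system in $\mathcal C$ with a cocone into a model $M$, $B=\operatorname{colim}_i B_i$ exists in $\mathcal C$, and $A\perp^M_C B_i$ for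 all $i$, then $A\perp^M_C B$. - *Local character*: for every $\lambda$ there is $\Upsilon(\lambda)$ such that for all subobjects $A,B$ of a model $M$ with $A$ $\lambda$-presentable there is a $\Upsilon(\lambda)$-presentable $B'\le B$ with $A\perp^M_{B'}B$. - *Stationarity*: for all objects $A,B$, every model $M$, arrows $a,b,m$ from $A,B,M$ to a model $N$ and arrows $a',b',m'$ from $A,B,M$ to a model $N'$: if $\operatorname{gtp}(a,m;N)=\operatorname{gtp}(a',m';N')$, $\operatorname{gtp}(b,m;N)=\operatorname{gtp}(b',m';N')$, $A\perp^N_M B$ and $A'\perp^{N'}_{M'}B'$ (where $A',B',M'$ are the subobjects of $N'$ represented by $a',b',m'$), then $\operatorname{gtp}(a,b,m;N)=\operatorname{gtp}(a',b',m';N')$. - *3-amalgamation*: let $M$ be a model, let $A,B,C$ be objects, and let $a_1,b_1,m_1$ from $A,B,M$ to $N_1$, $b_2,c_2,m_2$ from $B,C,M$ to $N_2$, and $c_3,a_3,m_3$ from $C,A,M$ to $N_3$ be arrows into models. Suppose that, for the represented subobjects, $A\perp^{N_1}_M B$, $B\perp^{N_2}_M C$, $C\perp^{N_3}_M A$, and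 that $\operatorname{gtp}(a_1,m_1;N_1)=\operatorname{gtp}(a_3,m_3;N_3)$, $\operatorname{gtp}(b_1,m_1;N_1)=\operatorname{gtp}(b_2,m_2;N_2)$, $\operatorname{gtp}(c_2,m_2;N_2)=\operatorname{gtp}(c_3,m_3;N_3)$. Then there are a model $N$ and extensions $N_1,N_2,N_3\to N$ such that the two resulting arrows $A\to N$ agree, and likewise those from $B$ and from $C$ and the three from $M$, and such that $A\perp^N_M N_2$. An independence relation that satisfies all of invariance, monotonicity, base-monotonicity, transitivity, symmetry, existence, union and local character is called *stable* if it also satisfies stationarity, and *simple* if it also satisfies 3-amalgamation. **Statement.** Let $(\mathcal C,\mathcal M)$ be an AECat with the amalgamation property. Then any two stable independence relations on it are equal. Moreover, if $\perp$ is a stable independence relation and $\perp'$ is a simple independence relation on $(\mathcal C,\mathcal M)$, then $\perp=\perp'$, that is, $A\perp^M_C B$ if and only if $A\perp'^{\,M}_C B$ for every model $M$ and all subobjects $A,B,C$ of $M$. -/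

import Mathlib

open CategoryTheory CategoryTheory.Limits

universe w v u

/-- An AECat `(C, M)`: both `C` and its full subcategory `M` of models are accessible, `M` has
(small) directed colimits which the inclusion into `C` preserves, and all arrows of `C` are
monomorphisms. The universe `w` is the universe of small sets. -/
structure AECat (C : Type u) [Category.{v} C] where
  /-- The objects of the full subcategory of models. -/
  isModel : ObjectProperty C
  accessible : IsAccessibleCategory.{w} C
  accessible_models : IsAccessibleCategory.{w} isModel.FullSubcategory
  hasDirectedColimits : ∀ (J : Type w) [PartialOrder J] [IsDirected J (· ≤ ·)] [Nonempty J],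
    HasColimitsOfShape J isModel.FullSubcategory
  preservesDirectedColimits : ∀ (J : Type w) [PartialOrder J] [IsDirected J (· ≤ ·)] [Nonempty J],
    PreservesColimitsOfShape J isModel.ι
  mono : ∀ {X Y : C} (f : X ⟶ Y), Mono f

namespace AECat

variable {C : Type u} [Category.{v} C] (𝒜 : AECat.{w} C)

/-- The models. As models form a full subcategory, an extension of models `M → N` is
an arbitrary arrow `M.obj ⟶ N.obj` of `C`. -/
abbrev Model := 𝒜.isModel.FullSubcategory

/-- The amalgamation property (for the category of models). -/
def HasAP : Prop :=
  ∀ (M N₁ N₂ : 𝒜.Model) (f₁ : M.obj ⟶ N₁.obj) (f₂ : M.obj ⟶ N₂.obj),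
    ∃ (U : 𝒜.Model) (g₁ : N₁.obj ⟶ U.obj) (g₂ : N₂.obj ⟶ U.obj), f₁ ≫ g₁ = f₂ ≫ g₂

/-- The subobject represented by an arrow. -/
def sub {X Y : C} (f : X ⟶ Y) : Subobject Y :=
  haveI := 𝒜.mono f
  Subobject.mk f

/-- A subobject of `X`, viewed as a subobject of `Y` along an arrow `f : X ⟶ Y`. -/
def push {X Y : C} (f : X ⟶ Y) (A : Subobject X) : Subobject Y :=
  haveI := 𝒜.mono f
  (Subobject.map f).obj A

/-- Equality of Galois types of pairs of arrows, `gtp(a, b; M) = gtp(a', b'; M')`. -/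
def GtpEq₂ {A B : C} {M M' : 𝒜.Model} (a : A ⟶ M.obj) (b : B ⟶ M.obj)
    (a' : A ⟶ M'.obj) (b' : B ⟶ M'.obj) : Prop :=
  ∃ (N : 𝒜.Model) (f : M.obj ⟶ N.obj) (g : M'.obj ⟶ N.obj),
    a ≫ f = a' ≫ g ∧ b ≫ f = b' ≫ g

/-- Equality of Galois types of triples of arrows, `gtp(a, b, c; M) = gtp(a', b', c'; M')`. -/
def GtpEq₃ {A B D : C} {M M' : 𝒜.Model} (a : A ⟶ M.obj) (b : B ⟶ M.obj) (c : D ⟶ M.obj)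
    (a' : A ⟶ M'.obj) (b' : B ⟶ M'.obj) (c' : D ⟶ M'.obj) : Prop :=
  ∃ (N : 𝒜.Model) (f : M.obj ⟶ N.obj) (g : M'.obj ⟶ N.obj),
    a ≫ f = a' ≫ g ∧ b ≫ f = b' ≫ g ∧ c ≫ f = c' ≫ g

/-- Equality of Galois types of triples of subobjects. -/
def SubGtpEq₃ {M M' : 𝒜.Model} (A B D : Subobject M.obj) (A' B' D' : Subobject M'.obj) : Prop :=
  ∃ (N : 𝒜.Model) (f : M.obj ⟶ N.obj) (g : M'.obj ⟶ N.obj),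
    𝒜.push f A = 𝒜.push g A' ∧ 𝒜.push f B = 𝒜.push g B' ∧ 𝒜.push f D = 𝒜.push g D'

/-- An independence relation: a relation on triples of subobjects of models.
`r M A B D` reads "`A` is independent from `B` over `D` in `M`": the base is the last argument. -/
abbrev IndepRel :=
  ∀ M : 𝒜.Model, Subobject M.obj → Subobject M.obj → Subobject M.obj → Prop

namespace IndepRel

variable {𝒜} (r : 𝒜.IndepRel)

def Invariance : Prop :=
  ∀ (M M' : 𝒜.Model) (A B D : Subobject M.obj) (A' B' D' : Subobject M'.obj),
    r M A B D → 𝒜.SubGtpEq₃ A B D A' B' D' → r M' A' B' D'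

def Monotonicity : Prop :=
  ∀ (M : 𝒜.Model) (A B D B' : Subobject M.obj), r M A B D → B' ≤ B → r M A B' D

def BaseMonotonicity : Prop :=
  ∀ (M : 𝒜.Model) (A B D D' : Subobject M.obj),
    r M A B D → D ≤ D' → D' ≤ B → r M A B D'

def Transitivity : Prop :=
  ∀ (M : 𝒜.Model) (A B D F : Subobject M.obj), r M A D B → r M A F D → B ≤ D →
    ∃ (N : 𝒜.Model) (f : M.obj ⟶ N.obj) (E : Subobject N.obj),
      r N (𝒜.push f A) E (𝒜.push f B) ∧ 𝒜.push f D ≤ E ∧ 𝒜.push f F ≤ E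

def Symmetry : Prop :=
  ∀ (M : 𝒜.Model) (A B D : Subobject M.obj), r M A B D → r M B A D

def Existence : Prop :=
  ∀ (M : 𝒜.Model) (A D : C) (a : A ⟶ M.obj) (c : D ⟶ M.obj) (B : Subobject M.obj),
    ∃ (M' : 𝒜.Model) (f : M.obj ⟶ M'.obj) (a' : A ⟶ M'.obj),
      r M' (𝒜.sub a') (𝒜.push f B) (𝒜.sub (c ≫ f)) ∧ 𝒜.GtpEq₂ a' (c ≫ f) a c

/-- `F` is a directed system in `C` with a colimit cocone `t`, and `β` is a cocone on `F` with
vertex the model `M`; the colimit is a subobject of `M` via the induced arrow. -/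
def Union : Prop :=
  ∀ (J : Type w) [PartialOrder J] [IsDirected J (· ≤ ·)] [Nonempty J]
    (F : J ⥤ C) (M : 𝒜.Model) (β : F ⟶ (Functor.const J).obj M.obj)
    (t : Cocone F) (ht : IsColimit t) (A D : Subobject M.obj),
    (∀ j : J, r M A (𝒜.sub (β.app j : F.obj j ⟶ M.obj)) D) →
      r M A (𝒜.sub (ht.desc (Cocone.mk M.obj β) : t.pt ⟶ M.obj)) D

def Stationarity : Prop :=
  ∀ (A B : C) (M N N' : 𝒜.Model)
    (a : A ⟶ N.obj) (b : B ⟶ N.obj) (m : M.obj ⟶ N.obj)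
    (a' : A ⟶ N'.obj) (b' : B ⟶ N'.obj) (m' : M.obj ⟶ N'.obj),
    𝒜.GtpEq₂ a m a' m' → 𝒜.GtpEq₂ b m b' m' →
    r N (𝒜.sub a) (𝒜.sub b) (𝒜.sub m) → r N' (𝒜.sub a') (𝒜.sub b') (𝒜.sub m') →
    𝒜.GtpEq₃ a b m a' b' m'

/-- For every regular `κ` there is a regular `υ` (the value at `κ` of a local character function)
such that every `κ`-presentable `A ≤ M` is independent from every `B ≤ M` over some
`υ`-presentable `B' ≤ B`. -/
def LocalCharacter : Prop :=
  ∀ (κ : Cardinal.{w}) [Fact κ.IsRegular], ∃ (υ : Cardinal.{w}) (_ : Fact υ.IsRegular),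
    ∀ (M : 𝒜.Model) (A B : Subobject M.obj), IsCardinalPresentable (A : C) κ →
      ∃ B' : Subobject M.obj, B' ≤ B ∧ IsCardinalPresentable (B' : C) υ ∧ r M A B B'

def ThreeAmalgamation : Prop :=
  ∀ (A B D : C) (M N₁ N₂ N₃ : 𝒜.Model)
    (a₁ : A ⟶ N₁.obj) (b₁ : B ⟶ N₁.obj) (m₁ : M.obj ⟶ N₁.obj)
    (b₂ : B ⟶ N₂.obj) (c₂ : D ⟶ N₂.obj) (m₂ : M.obj ⟶ N₂.obj)
    (c₃ : D ⟶ N₃.obj) (a₃ : A ⟶ N₃.obj) (m₃ : M.obj ⟶ N₃.obj),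
    r N₁ (𝒜.sub a₁) (𝒜.sub b₁) (𝒜.sub m₁) →
    r N₂ (𝒜.sub b₂) (𝒜.sub c₂) (𝒜.sub m₂) →
    r N₃ (𝒜.sub c₃) (𝒜.sub a₃) (𝒜.sub m₃) →
    𝒜.GtpEq₂ a₁ m₁ a₃ m₃ → 𝒜.GtpEq₂ b₁ m₁ b₂ m₂ → 𝒜.GtpEq₂ c₂ m₂ c₃ m₃ →
    ∃ (N : 𝒜.Model) (f₁ : N₁.obj ⟶ N.obj) (f₂ : N₂.obj ⟶ N.obj) (f₃ : N₃.obj ⟶ N.obj),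
      a₁ ≫ f₁ = a₃ ≫ f₃ ∧ b₁ ≫ f₁ = b₂ ≫ f₂ ∧ c₂ ≫ f₂ = c₃ ≫ f₃ ∧
      m₁ ≫ f₁ = m₂ ≫ f₂ ∧ m₂ ≫ f₂ = m₃ ≫ f₃ ∧
      r N (𝒜.sub (a₁ ≫ f₁)) (𝒜.sub f₂) (𝒜.sub (m₁ ≫ f₁))

/-- The properties that simple and stable independence relations share. -/
structure IsBasic : Prop where
  invariance : r.Invariance
  monotonicity : r.Monotonicity
  baseMonotonicity : r.BaseMonotonicity
  transitivity : r.Transitivity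
  symmetry : r.Symmetry
  existence : r.Existence
  union : r.Union
  localCharacter : r.LocalCharacter

/-- A stable independence relation. -/
structure IsStable : Prop extends r.IsBasic where
  stationarity : r.Stationarity

/-- A simple independence relation. -/
structure IsSimple : Prop extends r.IsBasic where
  threeAmalgamation : r.ThreeAmalgamation

end IndepRel

end AECat

/-! Everything reduces to bases that are models. By local character, a sufficiently long chain of
models has a member `P` such that a given `A` is independent over `P` from the union of the chain.
If copies `Bᵢ` of `B` over `M` are chosen along the chain, each independent over `M` from its
predecessors, it follows that `A` is independent over `M` from some `Bᵢ`. With a stable relation,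
any `A` independent from `B` over `M` looks like this up to equality of Galois types; with a simple
relation, 3-amalgamation lets one `A` have its given type over all `Bᵢ` at once. Finally, over
an arbitrary base `D` inside a model `M` there is a second copy of `M` which is independent from `M`
over `D` for both relations, and transitivity passes from the base `D` to that copy and back. -/

lemma exists_functor_forall_map_succ {D : Type*} [Category* D] [Nonempty D] (J : Type w)
    [LinearOrder J] [OrderBot J] [SuccOrder J] [WellFoundedLT J] [NoMaxOrder J]
    [HasIterationOfShape J D] (R : MorphismProperty D) (hR : ∀ X, ∃ (Y : D) (f : X ⟶ Y), R f) :
    ∃ F : J ⥤ D, ∀ j, R (F.map (homOfLE (Order.le_succ j))) := by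
  choose S t ht using hR
  let Φ : SmallObject.SuccStruct D := { X₀ := Classical.arbitrary D, succ := S, toSucc := t }
  have prop_le : Φ.prop ≤ R := by
    rintro _ _ _ ⟨_⟩
    exact ht _
  exact ⟨Φ.iterationFunctor J, fun j =>
    prop_le _ (Φ.prop_iterationFunctor_map_succ j (not_isMax j))⟩

namespace AECat

variable {C : Type u} [Category.{v} C] {𝒜 : AECat.{w} C}

section Subobject

variable (𝒜) {X Y Z : C}

lemma push_sub (a : X ⟶ Y) (f : Y ⟶ Z) : 𝒜.push f (𝒜.sub a) = 𝒜.sub (a ≫ f) :=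
  haveI := 𝒜.mono a
  haveI := 𝒜.mono f
  Subobject.map_mk a f

lemma sub_arrow (A : Subobject X) : 𝒜.sub A.arrow = A := Subobject.mk_arrow A

lemma push_eq_sub (f : X ⟶ Y) (A : Subobject X) : 𝒜.push f A = 𝒜.sub (A.arrow ≫ f) := by
  rw [← push_sub, sub_arrow]

lemma push_top (f : X ⟶ Y) : 𝒜.push f ⊤ = 𝒜.sub f :=
  haveI := 𝒜.mono f
  Subobject.map_top f

lemma push_id (A : Subobject X) : 𝒜.push (𝟙 X) A = A := Subobject.map_id A

lemma push_mono (f : X ⟶ Y) : Monotone (𝒜.push f) :=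
  haveI := 𝒜.mono f
  (Subobject.map f).monotone

lemma sub_comp_le (a : X ⟶ Y) (f : Y ⟶ Z) : 𝒜.sub (a ≫ f) ≤ 𝒜.sub f :=
  haveI := 𝒜.mono f
  haveI := 𝒜.mono (a ≫ f)
  Subobject.mk_le_mk_of_comm a rfl

lemma push_le_sub (f : X ⟶ Y) (A : Subobject X) : 𝒜.push f A ≤ 𝒜.sub f := by
  rw [push_eq_sub]
  exact 𝒜.sub_comp_le _ _

lemma isCardinalPresentable_sub (a : X ⟶ Y) (κ : Cardinal.{w}) [Fact κ.IsRegular]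
    [IsCardinalPresentable X κ] : IsCardinalPresentable (𝒜.sub a : C) κ :=
  haveI := 𝒜.mono a
  isCardinalPresentable_of_iso (Subobject.underlyingIso a).symm κ

end Subobject

lemma exists_isCardinalPresentable (𝒜 : AECat.{w} C) (X : C) :
    ∃ (κ : Cardinal.{w}) (_ : Fact κ.IsRegular), IsCardinalPresentable X κ :=
  haveI := 𝒜.accessible
  (inferInstance : IsPresentable.{w} X).exists_cardinal

section DirectedColimits

variable (J : Type w) [PartialOrder J] [IsDirected J (· ≤ ·)] [Nonempty J]

instance : HasColimitsOfShape J 𝒜.Model := 𝒜.hasDirectedColimits J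

instance : PreservesColimitsOfShape J 𝒜.isModel.ι := 𝒜.preservesDirectedColimits J

end DirectedColimits

namespace GtpEq₂

variable {A B : C} {M M' N : 𝒜.Model} {a : A ⟶ M.obj} {b : B ⟶ M.obj} {a' : A ⟶ M'.obj}
  {b' : B ⟶ M'.obj}

lemma symm (h : 𝒜.GtpEq₂ a b a' b') : 𝒜.GtpEq₂ a' b' a b := by
  obtain ⟨U, f, g, ha, hb⟩ := h
  exact ⟨U, g, f, ha.symm, hb.symm⟩

lemma of_comp_right {f : M'.obj ⟶ N.obj} (h : 𝒜.GtpEq₂ a b (a' ≫ f) (b' ≫ f)) :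
    𝒜.GtpEq₂ a b a' b' := by
  obtain ⟨U, g, k, ha, hb⟩ := h
  exact ⟨U, g, f ≫ k, by simpa using ha, by simpa using hb⟩

lemma comp_left (hAP : 𝒜.HasAP) (h : 𝒜.GtpEq₂ a b a' b') (f : M.obj ⟶ N.obj) :
    𝒜.GtpEq₂ (a ≫ f) (b ≫ f) a' b' := by
  obtain ⟨U, g, k, ha, hb⟩ := h
  obtain ⟨V, p, q, hpq⟩ := hAP M N U f g
  exact ⟨V, p, k ≫ q, by rw [Category.assoc, hpq, reassoc_of% ha],
    by rw [Category.assoc, hpq, reassoc_of% hb]⟩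

lemma comp_eq {X Y : C} {e : X ⟶ Y} {k : Y ⟶ M.obj} {k' : Y ⟶ M'.obj} {l : X ⟶ M'.obj}
    (h : 𝒜.GtpEq₂ k' l k (e ≫ k)) : e ≫ k' = l := by
  obtain ⟨U, f, g, hk, hl⟩ := h
  have := 𝒜.mono f
  rw [← cancel_mono f, Category.assoc, hk, hl, Category.assoc]

end GtpEq₂

namespace IndepRel

variable {r r' : 𝒜.IndepRel}

namespace Invariance

variable (hr : r.Invariance) {M M' N : 𝒜.Model}

include hr

lemma push_iff (f : M.obj ⟶ N.obj) {A B D : Subobject M.obj} :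
    r N (𝒜.push f A) (𝒜.push f B) (𝒜.push f D) ↔ r M A B D :=
  ⟨fun h => hr _ _ _ _ _ _ _ _ h ⟨N, 𝟙 _, f, by simp [push_id]⟩,
    fun h => hr _ _ _ _ _ _ _ _ h ⟨N, f, 𝟙 _, by simp [push_id]⟩⟩

lemma comp_iff (f : M.obj ⟶ N.obj) {A B D : C} {a : A ⟶ M.obj} {b : B ⟶ M.obj}
    {d : D ⟶ M.obj} :
    r N (𝒜.sub (a ≫ f)) (𝒜.sub (b ≫ f)) (𝒜.sub (d ≫ f)) ↔
      r M (𝒜.sub a) (𝒜.sub b) (𝒜.sub d) := by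
  simp only [← push_sub, hr.push_iff f]

lemma of_gtpEq₃ {A B D : C} {a : A ⟶ M.obj} {b : B ⟶ M.obj} {d : D ⟶ M.obj} {a' : A ⟶ M'.obj}
    {b' : B ⟶ M'.obj} {d' : D ⟶ M'.obj} (hgtp : 𝒜.GtpEq₃ a b d a' b' d')
    (h : r M (𝒜.sub a) (𝒜.sub b) (𝒜.sub d)) : r M' (𝒜.sub a') (𝒜.sub b') (𝒜.sub d') := by
  obtain ⟨N, f, g, ha, hb, hd⟩ := hgtp
  exact hr _ _ _ _ _ _ _ _ h ⟨N, f, g, by simp only [push_sub, ha, hb, hd, and_self]⟩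

end Invariance

lemma Existence.exists_indep_extension (hr : r.Existence) {M : 𝒜.Model} {A D : C} (a : A ⟶ M.obj)
    (d : D ⟶ M.obj) :
    ∃ (N : 𝒜.Model) (f : M.obj ⟶ N.obj) (a' : A ⟶ N.obj),
      r N (𝒜.sub a') (𝒜.sub f) (𝒜.sub (d ≫ f)) ∧ 𝒜.GtpEq₂ a' (d ≫ f) a d := by
  simpa only [push_top] using hr M A D a d ⊤

lemma Union.indep_of_isColimit (hr : r.Union) {J : Type w} [PartialOrder J]
    [IsDirected J (· ≤ ·)] [Nonempty J] {F : J ⥤ 𝒜.Model} {c : Cocone F} (hc : IsColimit c)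
    {N : 𝒜.Model} (f : c.pt.obj ⟶ N.obj) {A D : Subobject N.obj}
    (h : ∀ j, r N A (𝒜.sub ((c.ι.app j).hom ≫ f)) D) : r N A (𝒜.sub f) D := by
  let hc' := isColimitOfPreserves 𝒜.isModel.ι hc
  let β := ((𝒜.isModel.ι.mapCocone c).extend f).ι
  have desc_eq : hc'.desc (Cocone.mk N.obj β) = f :=
    (hc'.uniq (Cocone.mk N.obj β) f fun _ => rfl).symm
  simpa only [desc_eq] using hr J (F ⋙ 𝒜.isModel.ι) N β _ hc' A D h

/-- The properties of `IsBasic` other than union. They make independence over arbitrary bases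
comparable as soon as it is comparable over models (`IsPreBasic.le_of_leOverModels`). -/
structure IsPreBasic (r : 𝒜.IndepRel) : Prop where
  invariance : r.Invariance
  monotonicity : r.Monotonicity
  baseMonotonicity : r.BaseMonotonicity
  transitivity : r.Transitivity
  symmetry : r.Symmetry
  existence : r.Existence
  localCharacter : r.LocalCharacter

lemma IsBasic.isPreBasic (hr : r.IsBasic) : r.IsPreBasic where
  __ := hr

namespace IsPreBasic

section

variable (hr : r.IsPreBasic) {M : 𝒜.Model} {A A' B B' D F : Subobject M.obj}

include hr

lemma symm (h : r M A B D) : r M B A D := hr.symmetry _ _ _ _ h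

lemma mono_right (h : r M A B D) (hB : B' ≤ B) : r M A B' D := hr.monotonicity _ _ _ _ _ h hB

lemma mono_left (h : r M A B D) (hA : A' ≤ A) : r M A' B D :=
  hr.symm (hr.mono_right (hr.symm h) hA)

lemma mono_base (h : r M A B D) (hDF : D ≤ F) (hFB : F ≤ B) : r M A B F :=
  hr.baseMonotonicity _ _ _ _ _ h hDF hFB

lemma trans_right (h : r M A F D) (h' : r M A B F) (hDF : D ≤ F) : r M A B D := by
  obtain ⟨N, f, E, hE, -, hB⟩ := hr.transitivity M A D F B h h' hDF
  exact (hr.invariance.push_iff f).1 (hr.mono_right hE hB)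

lemma trans_left (h : r M F B D) (h' : r M A B F) (hDF : D ≤ F) : r M A B D :=
  hr.symm (hr.trans_right (hr.symm h) (hr.symm h') hDF)

variable (A D) in
lemma indep_base : r M A D D := by
  obtain ⟨M', f, a', h, U, g, k, ha, hd⟩ := hr.existence M _ _ A.arrow D.arrow D
  rw [push_eq_sub] at h
  simpa only [sub_arrow] using hr.invariance.of_gtpEq₃ ⟨U, g, k, ha, hd, hd⟩ h

lemma exists_base_le (h : r M A B D) :
    ∃ (N : 𝒜.Model) (f : M.obj ⟶ N.obj) (E : Subobject N.obj),
      r N (𝒜.push f A) E (𝒜.push f D) ∧ 𝒜.push f D ≤ E ∧ 𝒜.push f B ≤ E :=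
  hr.transitivity M A D D B (hr.indep_base A D) h le_rfl

end

lemma exists_indep_of_span (hAP : 𝒜.HasAP) (hr : r.IsPreBasic) {M N P : 𝒜.Model} {B : C}
    (b : B ⟶ N.obj) (m : M.obj ⟶ N.obj) (p : M.obj ⟶ P.obj) :
    ∃ (Q : 𝒜.Model) (f : P.obj ⟶ Q.obj) (b' : B ⟶ Q.obj),
      r Q (𝒜.sub b') (𝒜.sub f) (𝒜.sub (p ≫ f)) ∧ 𝒜.GtpEq₂ b' (p ≫ f) b m := by
  obtain ⟨U, g, k, hgk⟩ := hAP M N P m p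
  obtain ⟨Q, f, b', hb', hgtp⟩ := hr.existence.exists_indep_extension (b ≫ g) (m ≫ g)
  refine ⟨Q, k ≫ f, b', ?_, ?_⟩
  · rw [← reassoc_of% hgk, ← Category.assoc]
    exact hr.mono_right hb' (𝒜.sub_comp_le k f)
  · rw [← reassoc_of% hgk, ← Category.assoc]
    exact hgtp.of_comp_right

theorem exists_cardinal_forall_chain (hr : r.IsPreBasic) (A : C) :
    ∃ (κ : Cardinal.{w}) (_ : Fact κ.IsRegular),
      ∀ (P : κ.ord.ToType ⥤ 𝒜.Model) (p : Cocone P) (_ : IsColimit p) (N : 𝒜.Model)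
        (g : p.pt.obj ⟶ N.obj) (a : A ⟶ N.obj),
        ∃ j, r N (𝒜.sub a) (𝒜.sub g) (𝒜.sub ((p.ι.app j).hom ≫ g)) := by
  obtain ⟨κ, hκ, hA⟩ := 𝒜.exists_isCardinalPresentable A
  obtain ⟨υ, hυ, h⟩ := hr.localCharacter κ
  refine ⟨υ, hυ, fun P p hp N g a => ?_⟩
  obtain ⟨B, hB, hpres, hi⟩ := h N (𝒜.sub a) (𝒜.sub g) (𝒜.isCardinalPresentable_sub a κ)
  have : Nonempty υ.ord.ToType := by simpa using hυ.out.ne_zero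
  have := 𝒜.mono g
  have hB : B ≤ Subobject.mk g := hB
  obtain ⟨j, l, hl⟩ : ∃ j, ∃ l : (B : C) ⟶ (P.obj j).obj,
      l ≫ (p.ι.app j).hom = Subobject.ofLEMk B g hB :=
    IsCardinalPresentable.exists_hom_of_isColimit υ (isColimitOfPreserves 𝒜.isModel.ι hp) _
  refine ⟨j, hr.mono_base hi ?_ (𝒜.sub_comp_le _ _)⟩
  calc B = 𝒜.sub (l ≫ (p.ι.app j).hom ≫ g) := by
        rw [reassoc_of% hl, Subobject.ofLEMk_comp, sub_arrow]
    _ ≤ _ := 𝒜.sub_comp_le _ _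

/-- The objects of `D` are to be thought of as the stages of a transfinite construction with steps
in `R`, and `L` as the model built so far; iterating the steps gives the chain of models to which
local character is applied. -/
theorem exists_forall_indep_step (hr : r.IsPreBasic) {D : Type*} [Category* D] [Nonempty D]
    (L : D ⥤ 𝒜.Model)
    (hD : ∀ (J : Type w) [LinearOrder J] [Nonempty J], HasColimitsOfShape J D)
    (hL : ∀ (J : Type w) [LinearOrder J] [Nonempty J], PreservesColimitsOfShape J L)
    (R : MorphismProperty D) (hR : ∀ X, ∃ (Y : D) (f : X ⟶ Y), R f) (A : C) :
    ∃ U : D, ∀ (V : 𝒜.Model) (g : (L.obj U).obj ⟶ V.obj) (a : A ⟶ V.obj),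
      ∃ (X Y : D) (f : X ⟶ Y) (t : Y ⟶ U), R f ∧
        r V (𝒜.sub a) (𝒜.sub ((L.map t).hom ≫ g))
          (𝒜.sub ((L.map f).hom ≫ (L.map t).hom ≫ g)) := by
  obtain ⟨κ, hκ, hchain⟩ := hr.exists_cardinal_forall_chain A
  let J := κ.ord.ToType
  have : Nonempty J := by simpa [J] using hκ.out.ne_zero
  let : OrderBot J := WellFoundedLT.toOrderBot J
  have : NoMaxOrder J := Cardinal.noMaxOrder hκ.out.aleph0_le
  have : HasIterationOfShape J D :=
    { hasColimitsOfShape_of_isSuccLimit := fun j hj =>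
        haveI : Nonempty (Set.Iio j) := ⟨⟨⊥, hj.bot_lt⟩⟩
        hD (Set.Iio j)
      hasColimitsOfShape := hD J }
  obtain ⟨F, hF⟩ := exists_functor_forall_map_succ J R hR
  have := hL J
  refine ⟨colimit F, fun V g a => ?_⟩
  obtain ⟨j, hj⟩ := hchain (F ⋙ L) _ (isColimitOfPreserves L (colimit.isColimit F)) V g a
  let f : F.obj j ⟶ F.obj (Order.succ j) := F.map (homOfLE (Order.le_succ j))
  let t : F.obj (Order.succ j) ⟶ colimit F := colimit.ι F (Order.succ j)
  have hft : L.map (colimit.ι F j) = L.map f ≫ L.map t := by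
    rw [← L.map_comp, colimit.w]
  refine ⟨_, _, f, t, hF j, ?_⟩
  change r V _ _ (𝒜.sub ((L.map (colimit.ι F j)).hom ≫ g)) at hj
  rw [hft, ObjectProperty.FullSubcategory.comp_hom, Category.assoc] at hj
  exact hr.mono_right hj (𝒜.sub_comp_le _ _)

lemma indep_of_indep_step (hr : r.IsPreBasic) {P Q N : 𝒜.Model} {A B D : C} {a : A ⟶ N.obj}
    {b : B ⟶ Q.obj} {d : D ⟶ P.obj} {f : P.obj ⟶ Q.obj} {g : Q.obj ⟶ N.obj}
    (hb : r Q (𝒜.sub b) (𝒜.sub f) (𝒜.sub (d ≫ f)))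
    (ha : r N (𝒜.sub a) (𝒜.sub g) (𝒜.sub (f ≫ g))) :
    r N (𝒜.sub a) (𝒜.sub (b ≫ g)) (𝒜.sub ((d ≫ f) ≫ g)) := by
  have hb' := hr.symm ((hr.invariance.comp_iff g).2 hb)
  have ha' := hr.mono_right ha (𝒜.sub_comp_le b g)
  rw [Category.assoc] at hb' ⊢
  exact hr.trans_left hb' ha' (𝒜.sub_comp_le _ _)

theorem exists_forall_indep_realization (hAP : 𝒜.HasAP) (hr : r.IsPreBasic) {M : 𝒜.Model}
    {B D : C} (b : B ⟶ M.obj) (d : D ⟶ M.obj) (A : C) :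
    ∃ (U : 𝒜.Model) (f : M.obj ⟶ U.obj), ∀ (V : 𝒜.Model) (g : U.obj ⟶ V.obj) (a : A ⟶ V.obj),
      ∃ b' : B ⟶ U.obj, 𝒜.GtpEq₂ b' (d ≫ f) b d ∧
        r V (𝒜.sub a) (𝒜.sub (b' ≫ g)) (𝒜.sub ((d ≫ f) ≫ g)) := by
  let R : MorphismProperty (Under M) := fun _ Y f => ∃ b' : B ⟶ Y.right.obj,
    r Y.right (𝒜.sub b') (𝒜.sub f.right.hom) (𝒜.sub (d ≫ Y.hom.hom)) ∧
      𝒜.GtpEq₂ b' (d ≫ Y.hom.hom) b d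
  have hR : ∀ X, ∃ (Y : Under M) (f : X ⟶ Y), R f := fun X => by
    obtain ⟨N, f, b', hb', hgtp⟩ :=
      hr.existence.exists_indep_extension (b ≫ X.hom.hom) (d ≫ X.hom.hom)
    rw [Category.assoc] at hb' hgtp
    exact ⟨Under.mk (X.hom ≫ ObjectProperty.homMk f), Under.homMk (ObjectProperty.homMk f),
      b', hb', hgtp.of_comp_right⟩
  have : Nonempty (Under M) := ⟨Under.mk (𝟙 M)⟩
  obtain ⟨U, hU⟩ := hr.exists_forall_indep_step (Under.forget M) (fun _ _ _ => inferInstance)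
    (fun _ _ _ => inferInstance) R hR A
  refine ⟨U.right, U.hom.hom, fun V g a => ?_⟩
  obtain ⟨X, Y, f, t, ⟨b', hb', hgtp⟩, ha⟩ := hU V g a
  change r V _ (𝒜.sub (t.right.hom ≫ g)) (𝒜.sub (f.right.hom ≫ t.right.hom ≫ g)) at ha
  have hf : X.hom.hom ≫ f.right.hom = Y.hom.hom := congrArg (·.hom) (Under.w f)
  have ht : Y.hom.hom ≫ t.right.hom = U.hom.hom := congrArg (·.hom) (Under.w t)
  refine ⟨b' ≫ t.right.hom, ?_, ?_⟩
  · rw [← ht, ← Category.assoc]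
    exact hgtp.comp_left hAP t.right.hom
  · rw [← hf, ← Category.assoc] at hb'
    have := hr.indep_of_indep_step hb' ha
    simpa only [Category.assoc, reassoc_of% hf, reassoc_of% ht] using this

end IsPreBasic

/-- Inclusion of independence relations, restricted to bases represented by an arrow from a
model. -/
def LEOverModels (r r' : 𝒜.IndepRel) : Prop :=
  ∀ (M N : 𝒜.Model) (A B : Subobject N.obj) (m : M.obj ⟶ N.obj),
    r N A B (𝒜.sub m) → r' N A B (𝒜.sub m)

theorem Stationarity.leOverModels (hst : r.Stationarity) (hAP : 𝒜.HasAP) (hr : r.IsPreBasic)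
    (hr' : r'.IsPreBasic) : LEOverModels r r' := by
  intro M N A B m h
  rw [← 𝒜.sub_arrow A, ← 𝒜.sub_arrow B] at h ⊢
  obtain ⟨U, f, hU⟩ := hr'.exists_forall_indep_realization hAP B.arrow m A
  obtain ⟨V, g, a', ha', ha'_gtp⟩ :=
    hr.existence.exists_indep_extension (A.arrow ≫ f) (m ≫ f)
  obtain ⟨b', hb'_gtp, hb'⟩ := hU V g a'
  have gtp_eq : 𝒜.GtpEq₃ a' (b' ≫ g) ((m ≫ f) ≫ g) A.arrow B.arrow m :=
    hst _ _ _ _ _ _ _ _ _ _ _ ha'_gtp.of_comp_right (hb'_gtp.comp_left hAP g)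
      (hr.mono_right ha' (𝒜.sub_comp_le _ _)) h
  exact hr'.invariance.of_gtpEq₃ gtp_eq hb'

section ThreeAmalgamation

variable {M N : 𝒜.Model} (m : M ⟶ N) {A B : C} (a : A ⟶ N.obj) (b : B ⟶ N.obj)

/-- An object `X` of `Under (Arrow.mk m)` is a commutative square of models from `m : M ⟶ N` to some
`P ⟶ Q`; it is a stage if `A` is independent from `P` over `M` in `Q`. -/
def IsStage (r : 𝒜.IndepRel) : ObjectProperty (Under (Arrow.mk m)) := fun X =>
  r X.right.right (𝒜.sub (a ≫ X.hom.right.hom)) (𝒜.sub X.right.hom.hom)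
    (𝒜.sub (X.hom.left.hom ≫ X.right.hom.hom))

/-- A step from `P ⟶ Q` to `P' ⟶ Q'` adds to `P'` a copy of `B` that is independent from `P` over
`M` and has in `Q'` the same Galois type over `A` and `M` as the given `B`. -/
def IsStep (r : 𝒜.IndepRel) : MorphismProperty (Under (Arrow.mk m)) := fun _ Y f =>
  ∃ b' : B ⟶ Y.right.left.obj,
    r Y.right.left (𝒜.sub b') (𝒜.sub f.right.left.hom) (𝒜.sub Y.hom.left.hom) ∧
      𝒜.GtpEq₃ (a ≫ Y.hom.right.hom) (b' ≫ Y.right.hom.hom) (Y.hom.left.hom ≫ Y.right.hom.hom)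
        a b m.hom

variable {m a b}

lemma isStage_mk_id (hr : r.IsPreBasic) : IsStage m a r (Under.mk (𝟙 (Arrow.mk m))) := by
  simpa [IsStage] using hr.indep_base (𝒜.sub a) (𝒜.sub m.hom)

lemma isClosedUnderColimitsOfShape_isStage (hinv : r.Invariance) (hunion : r.Union)
    (J : Type w) [LinearOrder J] [Nonempty J] :
    (IsStage m a r).IsClosedUnderColimitsOfShape J where
  colimitsOfShape_le := by
    rintro X ⟨p⟩
    let hp := isColimitOfPreserves (Under.forget (Arrow.mk m) ⋙ Arrow.leftFunc) p.isColimit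
    refine hunion.indep_of_isColimit hp X.right.hom.hom fun j => ?_
    have hj := (hinv.comp_iff (p.ι.app j).right.right.hom).2 (p.prop_diag_obj j)
    have square : (p.ι.app j).right.left.hom ≫ X.right.hom.hom =
      (p.diag.obj j).right.hom.hom ≫ (p.ι.app j).right.right.hom :=
        congrArg (·.hom) (p.ι.app j).right.w
    have left_eq : (p.diag.obj j).hom.left.hom ≫ (p.ι.app j).right.left.hom = X.hom.left.hom :=
      congrArg (·.left.hom) (Under.w (p.ι.app j))
    have right_eq : (p.diag.obj j).hom.right.hom ≫ (p.ι.app j).right.right.hom =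
      X.hom.right.hom := congrArg (·.right.hom) (Under.w (p.ι.app j))
    simp only [Category.assoc, right_eq, ← square, reassoc_of% left_eq] at hj
    exact hj

lemma exists_isStep (hAP : 𝒜.HasAP) (hr : r.IsPreBasic) (hsymm : r'.Symmetry)
    (h3 : r'.ThreeAmalgamation) (hle : LEOverModels r r')
    (hab : r' N (𝒜.sub a) (𝒜.sub b) (𝒜.sub m.hom)) {X : Under (Arrow.mk m)}
    (hX : IsStage m a r' X) :
    ∃ (Y : Under (Arrow.mk m)) (f : X ⟶ Y), IsStep m a b r f ∧ IsStage m a r' Y := by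
  obtain ⟨P, f, b', hb', hb'_gtp⟩ := hr.exists_indep_of_span hAP b m.hom X.hom.left.hom
  have square : X.hom.left.hom ≫ X.right.hom.hom = m.hom ≫ X.hom.right.hom :=
    congrArg (·.hom) X.hom.w
  have ha_gtp : 𝒜.GtpEq₂ a m.hom (a ≫ X.hom.right.hom) (X.hom.left.hom ≫ X.right.hom.hom) :=
    ⟨X.right.right, X.hom.right.hom, 𝟙 _, by simp, by simp [square]⟩
  have hX_gtp : 𝒜.GtpEq₂ f (X.hom.left.hom ≫ f) X.right.hom.hom
      (X.hom.left.hom ≫ X.right.hom.hom) := by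
    obtain ⟨W, k, l, hkl⟩ := hAP _ _ _ f X.right.hom.hom
    exact ⟨W, k, l, hkl, by simp [hkl]⟩
  obtain ⟨Q, g₁, g₂, g₃, ha, hb, hX', hm₁, -, hQ⟩ :=
    h3 _ _ _ M N P X.right.right _ _ _ _ _ _ _ _ _ hab (hle _ _ _ _ _ hb') (hsymm _ _ _ _ hX)
      ha_gtp hb'_gtp.symm hX_gtp
  let g : X.right ⟶ Arrow.mk (ObjectProperty.homMk g₂ : P ⟶ Q) :=
    Arrow.homMk (ObjectProperty.homMk f) (ObjectProperty.homMk g₃) (by ext; exact hX')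
  rw [ha, hm₁] at hQ
  rw [Category.assoc] at ha hm₁
  exact ⟨Under.mk (X.hom ≫ g), Under.homMk g,
    ⟨b', hb', Q, 𝟙 _, g₁, by simp [g, ha], by simp [hb], by simp [g, hm₁]⟩,
    by simpa [IsStage, g] using hQ⟩

lemma IsStep.indep (hr : r.IsPreBasic) {X Y U : Under (Arrow.mk m)} {f : X ⟶ Y}
    (hf : IsStep m a b r f) (t : Y ⟶ U)
    (ha : r U.right.right (𝒜.sub (a ≫ U.hom.right.hom))
      (𝒜.sub (t.right.left.hom ≫ U.right.hom.hom))
      (𝒜.sub (f.right.left.hom ≫ t.right.left.hom ≫ U.right.hom.hom))) :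
    r N (𝒜.sub a) (𝒜.sub b) (𝒜.sub m.hom) := by
  obtain ⟨b', hb', hgtp⟩ := hf
  have left_eq : X.hom.left.hom ≫ f.right.left.hom = Y.hom.left.hom :=
    congrArg (·.left.hom) (Under.w f)
  have right_eq : Y.hom.right.hom ≫ t.right.right.hom = U.hom.right.hom :=
    congrArg (·.right.hom) (Under.w t)
  have square : t.right.left.hom ≫ U.right.hom.hom = Y.right.hom.hom ≫ t.right.right.hom :=
    congrArg (·.hom) t.right.w
  rw [← left_eq] at hb'
  have hU := hr.indep_of_indep_step hb' ha
  rw [left_eq, square, ← right_eq] at hU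
  simp only [← Category.assoc] at hU
  exact hr.invariance.of_gtpEq₃ hgtp ((hr.invariance.comp_iff t.right.right.hom).1 hU)

theorem ThreeAmalgamation.leOverModels (h3 : r'.ThreeAmalgamation) (hunion : r'.Union)
    (hAP : 𝒜.HasAP) (hr : r.IsPreBasic) (hr' : r'.IsPreBasic) (hle : LEOverModels r r') :
    LEOverModels r' r := by
  intro M N A B m₀ h
  rw [← 𝒜.sub_arrow A, ← 𝒜.sub_arrow B] at h ⊢
  let m : M ⟶ N := ObjectProperty.homMk m₀
  let S := IsStage m A.arrow r'
  have (J : Type w) [LinearOrder J] [Nonempty J] : S.IsClosedUnderColimitsOfShape J :=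
    isClosedUnderColimitsOfShape_isStage hr'.invariance hunion J
  have : Nonempty S.FullSubcategory := ⟨⟨_, isStage_mk_id hr'⟩⟩
  have exists_step (X : S.FullSubcategory) :
      ∃ (Y : S.FullSubcategory) (f : X ⟶ Y), IsStep m A.arrow B.arrow r f.hom := by
    obtain ⟨Y, f, hf, hY⟩ := exists_isStep hAP hr hr'.symmetry h3 hle h X.property
    exact ⟨⟨Y, hY⟩, ObjectProperty.homMk f, hf⟩
  obtain ⟨⟨U, _⟩, hU⟩ := hr.exists_forall_indep_step
    (S.ι ⋙ Under.forget (Arrow.mk m) ⋙ Arrow.leftFunc) (fun _ _ _ => inferInstance)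
    (fun _ _ _ => inferInstance) (fun _ _ f => IsStep m A.arrow B.arrow r f.hom) exists_step A
  obtain ⟨X, Y, f, t, hf, ha⟩ :=
    hU U.right.right U.right.hom.hom (A.arrow ≫ U.hom.right.hom)
  exact hf.indep hr t.hom ha

end ThreeAmalgamation

namespace IsPreBasic

lemma exists_indep_copies (hAP : 𝒜.HasAP) (hr : r.IsPreBasic) (hr' : r'.IsPreBasic)
    {M : 𝒜.Model} {D : C} (d : D ⟶ M.obj) :
    ∃ (V : 𝒜.Model) (e n : M.obj ⟶ V.obj), d ≫ e = d ≫ n ∧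
      r V (𝒜.sub e) (𝒜.sub n) (𝒜.sub (d ≫ e)) ∧ r' V (𝒜.sub e) (𝒜.sub n) (𝒜.sub (d ≫ e)) := by
  obtain ⟨U, f, hU⟩ := hr'.exists_forall_indep_realization hAP (𝟙 M.obj) d M.obj
  obtain ⟨V, g, e, he, he_gtp⟩ := hr.existence.exists_indep_extension f (d ≫ f)
  obtain ⟨n, hn_gtp, hn⟩ := hU V g e
  have de_eq : d ≫ e = (d ≫ f) ≫ g := he_gtp.comp_eq
  have dn_eq : d ≫ n = d ≫ f := GtpEq₂.comp_eq (k := 𝟙 M.obj) (by simpa using hn_gtp)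
  refine ⟨V, e, n ≫ g, by rw [de_eq, reassoc_of% dn_eq, Category.assoc], ?_, ?_⟩
  · rw [de_eq]
    exact hr.mono_right he (𝒜.sub_comp_le n g)
  · rwa [de_eq]

theorem le_of_leOverModels (hAP : 𝒜.HasAP) (hr : r.IsPreBasic) (hr' : r'.IsPreBasic)
    (hle : LEOverModels r r') : r ≤ r' := by
  intro M A B D h
  wlog hDB : D ≤ B generalizing M A B D
  · obtain ⟨N, f, E, hE, hDE, hBE⟩ := hr.exists_base_le h
    exact (hr'.invariance.push_iff f).1 (hr'.mono_right (this _ _ _ _ hE hDE) hBE)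
  obtain ⟨V, e, n, hD, he, he'⟩ := exists_indep_copies hAP hr hr' D.arrow
  rw [← push_eq_sub] at he he'
  have D_le_n : 𝒜.push e D ≤ 𝒜.sub n := by
    rw [push_eq_sub, hD]
    exact 𝒜.sub_comp_le _ _
  have A_indep_n : r V (𝒜.push e A) (𝒜.sub n) (𝒜.push e B) :=
    hr.symm (hr.mono_right
      (hr.mono_base (hr.symm he) (𝒜.push_mono e hDB) (𝒜.push_le_sub e B)) (𝒜.push_le_sub e A))
  obtain ⟨W, k, E, hE, hBE, hnE⟩ := hr.transitivity _ _ _ _ _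
    ((hr.invariance.push_iff e).2 h) A_indep_n (𝒜.push_mono e hDB)
  have over_n : r' W (𝒜.push k (𝒜.push e A)) E (𝒜.push k (𝒜.sub n)) := by
    have := hr.mono_base hE (𝒜.push_mono k D_le_n) hnE
    rw [push_sub] at this ⊢
    exact hle _ _ _ _ _ this
  have n_over_D : r' W (𝒜.push k (𝒜.push e A)) (𝒜.push k (𝒜.sub n)) (𝒜.push k (𝒜.push e D)) :=
    (hr'.invariance.push_iff k).2 (hr'.mono_left he' (𝒜.push_le_sub e A))
  have := hr'.trans_right n_over_D (hr'.mono_right over_n hBE) (𝒜.push_mono k D_le_n)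
  exact (hr'.invariance.push_iff e).1 ((hr'.invariance.push_iff k).1 this)

end IsPreBasic

end IndepRel

end AECat

open AECat.IndepRel in
theorem mainTheorem3_general {C : Type u} [Category.{v} C] {𝒜 : AECat.{w} C} (hAP : 𝒜.HasAP)
    {r₁ r₂ : 𝒜.IndepRel} (h₁ : r₁.IsPreBasic) (hst : r₁.Stationarity) (h₂ : r₂.IsPreBasic)
    (h : r₂.Stationarity ∨ r₂.Union ∧ r₂.ThreeAmalgamation) : r₁ = r₂ := by
  have hle : LEOverModels r₁ r₂ := hst.leOverModels hAP h₁ h₂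
  have hge : LEOverModels r₂ r₁ := by
    obtain hst₂ | ⟨hunion, h3⟩ := h
    · exact hst₂.leOverModels hAP h₂ h₁
    · exact h3.leOverModels hunion hAP h₁ h₂ hle
  exact le_antisymm (h₁.le_of_leOverModels hAP h₂ hle) (h₂.le_of_leOverModels hAP h₁ hge)

theorem mainTheorem3 {C : Type u} [Category.{v} C] (𝒜 : AECat.{w} C) (hAP : 𝒜.HasAP) :
    (∀ r₁ r₂ : 𝒜.IndepRel, r₁.IsStable → r₂.IsStable → r₁ = r₂) ∧
    (∀ r₁ r₂ : 𝒜.IndepRel, r₁.IsStable → r₂.IsSimple → r₁ = r₂) :=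
  ⟨fun _ _ h₁ h₂ => mainTheorem3_general hAP h₁.isPreBasic h₁.stationarity h₂.isPreBasic
    (.inl h₂.stationarity),
  fun _ _ h₁ h₂ => mainTheorem3_general hAP h₁.isPreBasic h₁.stationarity h₂.isPreBasic
    (.inr ⟨h₂.union, h₂.threeAmalgamation⟩)⟩
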